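/- Let $n_t,n_r\ge 1$ be integers, let $\mathcal X\subset\mathbb R^{n_t}$ be a convex compact set that contains the origin, and let $\mathsf H\in\mathbb R^{n_r\times n_t}$ be a fixed matrix. Let $\mathbf Z\sim\mathcal N(\mathbf 0,\mathsf I_{n_r})$ be independent of the input $\mathbf X$. All logarithms and mutual informations are to the base $2$. Define the capacity $$C=C(\mathcal X,\mathsf H):=\sup_{F_{\mathbf X}:\,\mathbf X\in\mathcal X\text{ a.s.}} I(\mathbf X;\mathsf H\mathbf X+\mathbf Z),$$ where the supremum is over all probability distributions on $\mathcal X$. Write $\mathsf H\mathcal X=\{\mathsf H\mathbf x:\mathbf x\in\mathcal X\}$, let $\mathcal B_{\mathbf 0}(r)$ be the closed Euclidean ball of radius $r$ about the origin of $\mathbb R^{n_r}$, and let $$d:=r_{\max}(\mathsf H\mathcal X):=\min\{r\ge 0:\mathsf H\mathcal X\subseteq\mathcal B_{\mathbf 0}(r)\}.$$ (1) We have $$C\le\log\left(c_{n_r}(d)+\frac{\mathrm{Vol}(\mathcal B_{\mathbf 0}(d))}{(2\pi e)^{n_r/2}}\right),\qquad c_n(r):=\sum_{i=0}^{n-1}\binom{n-1}{i}\frac{\Gamma\left(\frac{n-i}{2}\right)}{2^{i/2}\,\Gamma\left(\frac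 n2\right)}\,r^i .$$ (2) For $\mathbf a=(A_1,\dots,A_{n_r})$ with all $A_i\ge 0$ let $\mathrm{Box}(\mathbf a):=\{\mathbf y\in\mathbb R^{n_r}:|y_i|\le A_i,\ i=1,\dots,n_r\}$, and let $\mathrm{Box}(\mathsf H\mathcal X)$ be the smallest box containing $\mathsf H\mathcal X$, that is, the intersection of all boxes $\mathrm{Box}(\mathbf a)$ that contain $\mathsf H\mathcal X$. Then there is such an $\mathbf a$ with $\mathrm{Box}(\mathbf a)=\mathrm{Box}(\mathsf H\mathcal X)$, and for every such $\mathbf a$ $$C\le\sum_{i=1}^{n_r}\log\left(1+\frac{2A_i}{\sqrt{2\pi e}}\right).$$ -/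

import Mathlib

open MeasureTheory ProbabilityTheory
open scoped ENNReal

/-- `I(U;V)` in bits, as a function of the joint law of `(U, V)`: the Kullback-Leibler divergence
of the joint law from the product of its marginals (`klDiv` is in nats). -/
noncomputable def mutualInfoBits {α β : Type*} [MeasurableSpace α] [MeasurableSpace β]
    (joint : Measure (α × β)) : ℝ≥0∞ :=
  InformationTheory.klDiv joint (joint.fst.prod joint.snd) / ENNReal.ofReal (Real.log 2)

/-- The set `H S = {H x : x ∈ S}`. -/
def matImage {k n : ℕ} (H : Matrix (Fin k) (Fin n) ℝ) (S : Set (EuclideanSpace ℝ (Fin n))) :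
    Set (EuclideanSpace ℝ (Fin k)) :=
  Matrix.toEuclideanLin H '' S

/-- The joint law of `(X, H X + Z)`, where `X` has law `P` and `Z`, independent of `X`, is a
standard Gaussian vector. -/
noncomputable def channelJointLaw {nr nt : ℕ} (H : Matrix (Fin nr) (Fin nt) ℝ)
    (P : Measure (EuclideanSpace ℝ (Fin nt))) :
    Measure (EuclideanSpace ℝ (Fin nt) × EuclideanSpace ℝ (Fin nr)) :=
  (P.prod (stdGaussian (EuclideanSpace ℝ (Fin nr)))).map
    (fun p => (p.1, Matrix.toEuclideanLin H p.1 + p.2))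

/-- The capacity `C(𝒳, H)` in bits: the supremum of `I(X; H X + Z)` over all laws `P` of an input
`X` with values in `𝒳`. -/
noncomputable def channelCapacity {nr nt : ℕ} (𝒳 : Set (EuclideanSpace ℝ (Fin nt)))
    (H : Matrix (Fin nr) (Fin nt) ℝ) : ℝ≥0∞ :=
  ⨆ (P : Measure (EuclideanSpace ℝ (Fin nt))) (_ : IsProbabilityMeasure P)
    (_ : ∀ᵐ x ∂P, x ∈ 𝒳), mutualInfoBits (channelJointLaw H P)

/-- The smallest `r ≥ 0` such that `S` lies in the closed ball of radius `r` about the origin. -/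
noncomputable def rMax {n : ℕ} (S : Set (EuclideanSpace ℝ (Fin n))) : ℝ :=
  sInf {r : ℝ | 0 ≤ r ∧ S ⊆ Metric.closedBall 0 r}

/-- `Box(a) = {x : |x i| ≤ a i for all i}`. -/
def box {n : ℕ} (a : Fin n → ℝ) : Set (EuclideanSpace ℝ (Fin n)) :=
  {x | ∀ i, |x i| ≤ a i}

/-- `Box(S)`: the intersection of all boxes `Box(a)`, `a ≥ 0`, that contain `S`. -/
def smallestBox {n : ℕ} (S : Set (EuclideanSpace ℝ (Fin n))) : Set (EuclideanSpace ℝ (Fin n)) :=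
  ⋂₀ {B | ∃ a : Fin n → ℝ, (∀ i, 0 ≤ a i) ∧ S ⊆ box a ∧ B = box a}

/-- `c_n(r) = ∑_{i=0}^{n-1} (n-1 choose i) Γ((n-i)/2) / (2^{i/2} Γ(n/2)) r^i`. -/
noncomputable def dualityCoeff (n : ℕ) (r : ℝ) : ℝ :=
  ∑ i ∈ Finset.range n, ((n - 1).choose i : ℝ) *
    (Real.Gamma (((n : ℝ) - i) / 2) / ((2 : ℝ) ^ ((i : ℝ) / 2) * Real.Gamma ((n : ℝ) / 2))) * r ^ i

/-!
The bounds come from the duality upper bound on mutual information. For every probability measure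
`R` on the output space, `I(X; Y)` is at most the divergence of the joint law from
`P_X × R`, i.e. the average over `x` of the divergence of the law of `H x + Z` from `R`
(`klDiv_prod_snd_le`). If `R` has density `exp (-ρ) / ((2π)^(n/2) K)`, then that divergence is
`log K + E[ρ (H x + Z) - ‖Z‖² / 2]`, so `log K` bounds the capacity as soon as the expectation is
nonpositive for every admissible `x` (`klDiv_gaussianChannel_le`).

For the first bound, `ρ` is `n / 2` on the ball of radius `d` and `(‖y‖ - d)² / 2` outside of it.
The normalising constant `K` is computed in polar coordinates
(`integral_exp_neg_shellPotential`). As `E ‖Z‖² = n`, the expectation is one half of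
`E[(‖Y‖ - d)² - n; ‖Y‖ > d]` with `Y = s + Z` and `‖s‖ ≤ d`. Along each ray from the origin this is,
up to a positive factor,
`∫_{t > 0} (t + d)^(n-1) (t² - n) exp (-(t + a)² / 2) dt` with `a = d - ⟪θ, s⟫ ≥ 0`.
For `a = d = 0` this integral is zero. In general the integrand is multiplied by the decreasing
factor `(1 + d / t)^(n-1) exp (-a t - a² / 2)`, which favours the region where `t² - n` is negative,
so the integral is nonpositive (`integral_radial_moment_le`).

For the second bound, `ρ` is the sum over the coordinates of the one-dimensional potentials with
radii `A i`. Both the normalisation and the expectation split into one-dimensional cases of the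
computation above, in which the coefficient `dualityCoeff 1` is `1`.
-/

open Set

/-! ### The duality bound on mutual information -/

/-- Among the product measures `μ.fst.prod R`, the one built from the second marginal of `μ` is
closest to `μ`. This is the chain rule for the divergence of `μ`, disintegrated over its second
coordinate, from `R.prod μ.fst`: the marginals contribute the extra term `klDiv μ.snd R`. -/
lemma klDiv_prod_snd_le {α β : Type*} [MeasurableSpace α] [MeasurableSpace β]
    [StandardBorelSpace α] [Nonempty α] (μ : Measure (α × β)) [IsProbabilityMeasure μ]
    (R : Measure β) [IsProbabilityMeasure R] :
    InformationTheory.klDiv μ (μ.fst.prod μ.snd) ≤ InformationTheory.klDiv μ (μ.fst.prod R) := by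
  set ν := μ.map Prod.swap with hν
  have hνp : IsProbabilityMeasure ν := Measure.isProbabilityMeasure_map (by fun_prop)
  have hfst : ν.fst = μ.snd := by rw [hν, Measure.fst_map_swap]
  have hdis : μ.snd ⊗ₘ ν.condKernel = ν := by rw [← hfst]; exact ν.disintegrate ν.condKernel
  have hswap : ν.map Prod.swap = μ := by
    rw [hν, Measure.map_map measurable_swap measurable_swap]; simp
  have chain := InformationTheory.klDiv_compProd_eq_add μ.snd R ν.condKernel
    (Kernel.const β μ.fst)
  rw [hdis, Measure.compProd_const, Measure.compProd_const] at chain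
  calc InformationTheory.klDiv μ (μ.fst.prod μ.snd)
      = InformationTheory.klDiv (ν.map Prod.swap) ((μ.snd.prod μ.fst).map Prod.swap) := by
        rw [hswap, Measure.prod_swap]
    _ ≤ InformationTheory.klDiv ν (μ.snd.prod μ.fst) :=
        InformationTheory.klDiv_map_le _ _ measurable_swap
    _ ≤ InformationTheory.klDiv ν (R.prod μ.fst) := by rw [chain]; exact le_add_self
    _ = InformationTheory.klDiv (μ.map Prod.swap) ((μ.fst.prod R).map Prod.swap) := by
        rw [Measure.prod_swap]
    _ ≤ _ := InformationTheory.klDiv_map_le _ _ measurable_swap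

/-- The normalising constant `(2π)^(dim E / 2)` of the standard Gaussian density on `E`. -/
noncomputable def gaussConst (E : Type*) [NormedAddCommGroup E] [InnerProductSpace ℝ E] : ℝ :=
  (2 * Real.pi) ^ ((Module.finrank ℝ E : ℝ) / 2)

lemma gaussConst_pos {E : Type*} [NormedAddCommGroup E] [InnerProductSpace ℝ E] :
    0 < gaussConst E := by unfold gaussConst; positivity

section
variable {E : Type*} [NormedAddCommGroup E] [InnerProductSpace ℝ E] [FiniteDimensional ℝ E]
  [MeasurableSpace E] [BorelSpace E]

lemma integral_exp_neg_norm_sq_div_two : ∫ z : E, Real.exp (-‖z‖ ^ 2 / 2) = gaussConst E := by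
  have := GaussianFourier.integral_rexp_neg_mul_sq_norm (V := E) (b := 1 / 2) (by norm_num)
  rw [gaussConst, show 2 * Real.pi = Real.pi / (1 / 2) by ring, ← this]
  congr with z
  ring_nf

lemma integrable_exp_neg_norm_sq_div_two :
    Integrable (fun z : E ↦ Real.exp (-‖z‖ ^ 2 / 2)) := by
  refine Integrable.of_integral_ne_zero ?_
  rw [integral_exp_neg_norm_sq_div_two]
  exact gaussConst_pos.ne'

/-- The Lebesgue density of the standard Gaussian, identified by its characteristic function. -/
lemma stdGaussian_eq_withDensity : stdGaussian E =
    (volume : Measure E).withDensity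
      (fun z ↦ ENNReal.ofReal (Real.exp (-‖z‖ ^ 2 / 2) / gaussConst E)) := by
  have hpos := gaussConst_pos (E := E)
  have hfin : IsFiniteMeasure ((volume : Measure E).withDensity
      (fun z ↦ ENNReal.ofReal (Real.exp (-‖z‖ ^ 2 / 2) / gaussConst E))) :=
    isFiniteMeasure_withDensity_ofReal
      (integrable_exp_neg_norm_sq_div_two.div_const _).hasFiniteIntegral
  refine Measure.ext_of_charFun ?_
  ext t
  rw [charFun_stdGaussian, charFun_apply, integral_withDensity_eq_integral_toReal_smul
    (by fun_prop) (by simp)]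
  have key := GaussianFourier.integral_cexp_neg_mul_sq_norm_add (V := E) (b := 1 / 2)
    (by norm_num) Complex.I t
  have : ∀ z : E, (ENNReal.ofReal (Real.exp (-‖z‖ ^ 2 / 2) / gaussConst E)).toReal •
      Complex.exp (inner ℝ z t * Complex.I) = (gaussConst E : ℂ)⁻¹ *
        Complex.exp (-(1 / 2) * ‖z‖ ^ 2 + Complex.I * inner ℝ t z) := by
    intro z
    rw [ENNReal.toReal_ofReal (by positivity), Complex.exp_add, Complex.real_smul,
      real_inner_comm]
    push_cast
    rw [show (-(1 / 2) * (‖z‖ : ℂ) ^ 2) = -‖z‖ ^ 2 / 2 by ring, mul_comm Complex.I]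
    ring
  simp_rw [this, integral_const_mul, key]
  have hc : ((Real.pi : ℂ) / (1 / 2)) ^ (Module.finrank ℝ E / 2 : ℂ) = gaussConst E := by
    rw [gaussConst, Complex.ofReal_cpow (by positivity)]
    push_cast
    congr 1
    ring
  rw [hc, ← mul_assoc, inv_mul_cancel₀ (by exact_mod_cast hpos.ne'), one_mul, Complex.I_sq]
  congr 1
  ring

/-- **Duality bound** for the channel `x ↦ L x + Z`, in nats. The comparison output law has density
`exp (-ρ) / ((2π)^(n/2) K)`, and the average of `ρ (L x + Z) - ‖Z‖² / 2` is the divergence of the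
law of `L x + Z` from it, less `log K`. -/
lemma klDiv_gaussianChannel_le {F : Type*} [MeasurableSpace F] [StandardBorelSpace F] [Nonempty F]
    (P : Measure F) [IsProbabilityMeasure P] {L : F → E} (hL : Measurable L)
    {ρ : E → ℝ} (hρ : Measurable ρ) {K : ℝ} (hK : 0 < K)
    (hnorm : ∫ y, Real.exp (-ρ y) = gaussConst E * K)
    (hint : Integrable (fun p : F × E ↦ ρ (L p.1 + p.2) - ‖p.2‖ ^ 2 / 2)
      (P.prod (stdGaussian E)))
    (hle : ∀ᵐ x ∂P, ∫ z, (ρ (L x + z) - ‖z‖ ^ 2 / 2) ∂(stdGaussian E) ≤ 0) :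
    let J := (P.prod (stdGaussian E)).map (fun p ↦ (p.1, L p.1 + p.2))
    InformationTheory.klDiv J (J.fst.prod J.snd) ≤ ENNReal.ofReal (Real.log K) := by
  intro J
  have hg := gaussConst_pos (E := E)
  set S : F × E → F × E := fun p ↦ (p.1, L p.1 + p.2) with hS
  have hSm : Measurable S := by fun_prop
  have hJp : IsProbabilityMeasure J := Measure.isProbabilityMeasure_map hSm.aemeasurable
  have hJfst : J.fst = P := by
    rw [Measure.fst, Measure.map_map measurable_fst hSm]
    exact Measure.fst_prod
  set r : E → ℝ≥0∞ := fun y ↦ ENNReal.ofReal (Real.exp (-ρ y) / (gaussConst E * K)) with hr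
  have hrm : Measurable r := by fun_prop
  set R : Measure E := volume.withDensity r with hR
  have hexpint : Integrable (fun y ↦ Real.exp (-ρ y)) :=
    Integrable.of_integral_ne_zero (by rw [hnorm]; positivity)
  have hRp : IsProbabilityMeasure R := by
    refine ⟨?_⟩
    rw [hR, withDensity_apply _ .univ, Measure.restrict_univ,
      ← ofReal_integral_eq_lintegral_ofReal (hexpint.div_const _)
        (ae_of_all _ fun y ↦ by positivity), integral_div, hnorm,
      div_self (by positivity), ENNReal.ofReal_one]
  -- `R'` is the pull-back of `P.prod R` along the shear `S`: comparing `P.prod γ` with it avoids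
  -- handling the density of `J` itself
  set R' : Measure (F × E) := (P.prod volume).withDensity (fun p ↦ r (L p.1 + p.2)) with hR'
  have hpres : MeasurePreserving S (P.prod volume) (P.prod volume) :=
    (MeasurePreserving.id P).skew_product (g := fun x z ↦ L x + z) (by fun_prop)
      (ae_of_all _ fun x ↦ (measurePreserving_add_left volume (L x)).map_eq)
  have hmapR : R'.map S = P.prod R := by
    rw [hR, prod_withDensity_right hrm]
    ext s hs
    rw [Measure.map_apply hSm hs, hR', withDensity_apply _ (hSm hs), withDensity_apply _ hs,
      ← hpres.setLIntegral_comp_preimage hs (by fun_prop)]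
  have hR'p : IsProbabilityMeasure R' := by
    have : R' Set.univ = 1 := by
      rw [← Set.preimage_univ (f := S), ← Measure.map_apply hSm .univ, hmapR, measure_univ]
    exact ⟨this⟩
  set g : F × E → ℝ := fun p ↦ Real.log K + (ρ (L p.1 + p.2) - ‖p.2‖ ^ 2 / 2) with hgdef
  have hgm : Measurable g := by fun_prop
  have hdens : P.prod (stdGaussian E) =
      R'.withDensity (fun p ↦ ENNReal.ofReal (Real.exp (g p))) := by
    rw [stdGaussian_eq_withDensity, prod_withDensity_right (by fun_prop), hR',
      ← withDensity_mul _ (by fun_prop) (by fun_prop)]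
    congr with p
    rw [Pi.mul_apply, hr, ← ENNReal.ofReal_mul (by positivity)]
    congr 1
    rw [hgdef, Real.exp_add, Real.exp_log hK, Real.exp_sub, Real.exp_neg,
      show -‖p.2‖ ^ 2 / 2 = -(‖p.2‖ ^ 2 / 2) by ring, Real.exp_neg]
    have := Real.exp_pos (ρ (L p.1 + p.2))
    field_simp
  have hgint : Integrable g (P.prod (stdGaussian E)) := (integrable_const _).add hint
  have hac : P.prod (stdGaussian E) ≪ R' := by
    rw [hdens]; exact withDensity_absolutelyContinuous _ _
  have hllr : llr (P.prod (stdGaussian E)) R' =ᵐ[P.prod (stdGaussian E)] g := by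
    refine hac.ae_le ?_
    have := Measure.rnDeriv_withDensity R' (f := fun p ↦ ENNReal.ofReal (Real.exp (g p)))
      (by fun_prop)
    rw [← hdens] at this
    filter_upwards [this] with p hp
    rw [llr, hp, ENNReal.toReal_ofReal (by positivity), Real.log_exp]
  calc InformationTheory.klDiv J (J.fst.prod J.snd)
      ≤ InformationTheory.klDiv J (J.fst.prod R) := klDiv_prod_snd_le J R
    _ = InformationTheory.klDiv ((P.prod (stdGaussian E)).map S) (R'.map S) := by
        rw [hJfst, hmapR]
    _ ≤ InformationTheory.klDiv (P.prod (stdGaussian E)) R' :=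
        InformationTheory.klDiv_map_le _ _ hSm
    _ = ENNReal.ofReal (∫ p, g p ∂(P.prod (stdGaussian E))) := by
        rw [InformationTheory.klDiv_of_ac_of_integrable hac ((integrable_congr hllr).2 hgint),
          integral_congr_ae hllr]
        simp
    _ ≤ ENNReal.ofReal (Real.log K) := by
        refine ENNReal.ofReal_le_ofReal ?_
        rw [hgdef, integral_add (integrable_const _) hint, integral_prod _ hint]
        have := integral_nonpos_of_ae hle
        simpa using this

end

/-! ### One-dimensional radial integrals -/

lemma integrableOn_pow_mul_exp_neg_sq_div_two (k : ℕ) :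
    IntegrableOn (fun t : ℝ ↦ t ^ k * Real.exp (-t ^ 2 / 2)) (Ioi 0) := by
  have := integrableOn_rpow_mul_exp_neg_mul_sq (b := 1 / 2) (by norm_num) (s := k)
    (by linarith [k.cast_nonneg (α := ℝ)])
  refine this.congr_fun (fun t _ ↦ ?_) measurableSet_Ioi
  simp only [Real.rpow_natCast]
  ring_nf

lemma integral_pow_mul_exp_neg_sq_div_two (k : ℕ) :
    ∫ t in Ioi (0 : ℝ), t ^ k * Real.exp (-t ^ 2 / 2) =
      2 ^ (((k : ℝ) + 1) / 2) / 2 * Real.Gamma (((k : ℝ) + 1) / 2) := by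
  have := integral_rpow_mul_exp_neg_mul_rpow (p := 2) (q := k) (b := 1 / 2) (by norm_num)
    (by linarith [k.cast_nonneg (α := ℝ)]) (by norm_num)
  rw [show (2 : ℝ) ^ (((k : ℝ) + 1) / 2) / 2 = (1 / 2) ^ (-((k : ℝ) + 1) / 2) * (1 / 2) by
    rw [one_div, Real.inv_rpow (by norm_num), ← Real.rpow_neg (by norm_num), neg_div, neg_neg]
    ring, ← this]
  refine setIntegral_congr_fun measurableSet_Ioi fun t _ ↦ ?_
  simp only [Real.rpow_natCast, Real.rpow_two]
  ring_nf

lemma setIntegral_Ioi_eq_comp_add (f : ℝ → ℝ) (d : ℝ) :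
    ∫ r in Ioi d, f r = ∫ t in Ioi (0 : ℝ), f (t + d) := by
  rw [← (measurePreserving_add_right volume d).setIntegral_preimage_emb
    (measurableEmbedding_addRight d)]
  simp

/-- For `a = d = 0` the integral vanishes, because the integrand is the derivative of
`-t ^ (m + 1) * exp (-t² / 2)`. In general the integrand is that one times a decreasing function
`g`, which puts more weight where `t² - (m + 1)` is negative. -/
lemma integral_radial_moment_le {m : ℕ} {d a : ℝ} (hd : 0 ≤ d) (ha : 0 ≤ a) :
    ∫ t in Ioi (0 : ℝ), (t + d) ^ m * ((t ^ 2 - (m + 1)) * Real.exp (-(t + a) ^ 2 / 2)) ≤ 0 := by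
  set g : ℝ → ℝ := fun t ↦ (1 + d / t) ^ m * Real.exp (-a * t - a ^ 2 / 2) with hg
  -- the point where `t² - (m + 1)` changes sign
  set τ : ℝ := √(m + 1) with hτ
  have hτ0 : 0 < τ := Real.sqrt_pos.2 (by positivity)
  have hτsq : τ ^ 2 = m + 1 := Real.sq_sqrt (by positivity)
  have hanti : ∀ s t, 0 < s → s ≤ t → g t ≤ g s := by
    intro s t hs hst
    have ht : 0 < t := hs.trans_le hst
    simp only [hg]
    gcongr ?_ ^ m * Real.exp ?_
    · gcongr
    · nlinarith
  have hint : IntegrableOn (fun t : ℝ ↦ g τ *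
      (t ^ (m + 2) * Real.exp (-t ^ 2 / 2) - (m + 1) * (t ^ m * Real.exp (-t ^ 2 / 2))))
      (Ioi 0) :=
    ((integrableOn_pow_mul_exp_neg_sq_div_two (m + 2)).sub
      ((integrableOn_pow_mul_exp_neg_sq_div_two m).const_mul _)).const_mul _
  by_cases hI : IntegrableOn
      (fun t : ℝ ↦ (t + d) ^ m * ((t ^ 2 - (m + 1)) * Real.exp (-(t + a) ^ 2 / 2))) (Ioi 0)
  swap
  · rw [integral_undef hI]
  calc _ ≤ ∫ t in Ioi (0 : ℝ), g τ *
      (t ^ (m + 2) * Real.exp (-t ^ 2 / 2) - (m + 1) * (t ^ m * Real.exp (-t ^ 2 / 2))) := by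
        refine setIntegral_mono_on hI hint measurableSet_Ioi fun t ht ↦ ?_
        have ht : 0 < t := ht
        have h1 : (t + d) ^ m * ((t ^ 2 - (m + 1)) * Real.exp (-(t + a) ^ 2 / 2)) =
            (t ^ 2 - (m + 1)) * g t * (t ^ m * Real.exp (-t ^ 2 / 2)) := by
          have e1 : t + d = t * (1 + d / t) := by field_simp
          have e2 : Real.exp (-(t + a) ^ 2 / 2) =
              Real.exp (-a * t - a ^ 2 / 2) * Real.exp (-t ^ 2 / 2) := by
            rw [← Real.exp_add]; ring_nf
          rw [e1, e2, mul_pow]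
          simp only [hg]
          ring
        have h2 : g τ * (t ^ (m + 2) * Real.exp (-t ^ 2 / 2)
            - (m + 1) * (t ^ m * Real.exp (-t ^ 2 / 2))) =
            (t ^ 2 - (m + 1)) * g τ * (t ^ m * Real.exp (-t ^ 2 / 2)) := by ring
        rw [h1, h2]
        refine mul_le_mul_of_nonneg_right ?_ (by positivity)
        rw [← hτsq]
        rcases le_total t τ with h | h
        · have h3 : t ^ 2 ≤ τ ^ 2 := by gcongr
          nlinarith [hanti t τ ht h]
        · have h3 : τ ^ 2 ≤ t ^ 2 := by gcongr
          nlinarith [hanti τ t hτ0 h]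
    _ = 0 := by
        rw [integral_const_mul, integral_sub (integrableOn_pow_mul_exp_neg_sq_div_two (m + 2))
          ((integrableOn_pow_mul_exp_neg_sq_div_two m).const_mul _), integral_const_mul,
          integral_pow_mul_exp_neg_sq_div_two, integral_pow_mul_exp_neg_sq_div_two]
        have e : (((m + 2 : ℕ) : ℝ) + 1) / 2 = ((m : ℝ) + 1) / 2 + 1 := by push_cast; ring
        rw [e, Real.Gamma_add_one (by positivity), Real.rpow_add_one (by norm_num)]
        ring

lemma add_pow_mul_exp_eq_sum (m : ℕ) (d t : ℝ) :
    (t + d) ^ m * Real.exp (-t ^ 2 / 2) = ∑ i ∈ Finset.range (m + 1),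
      (m.choose i : ℝ) * d ^ i * (t ^ (m - i) * Real.exp (-t ^ 2 / 2)) := by
  rw [add_comm t d, add_pow, Finset.sum_mul]
  exact Finset.sum_congr rfl fun i _ ↦ by ring

lemma integrableOn_add_pow_mul_exp (m : ℕ) (d : ℝ) :
    IntegrableOn (fun t : ℝ ↦ (t + d) ^ m * Real.exp (-t ^ 2 / 2)) (Ioi 0) := by
  simp_rw [add_pow_mul_exp_eq_sum]
  exact integrable_finsetSum _ fun i _ ↦
    (integrableOn_pow_mul_exp_neg_sq_div_two (m - i)).const_mul _

lemma integral_add_pow_mul_exp (m : ℕ) (d : ℝ) :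
    ∫ t in Ioi (0 : ℝ), (t + d) ^ m * Real.exp (-t ^ 2 / 2) =
      2 ^ (((m + 1 : ℕ) : ℝ) / 2) / 2 * Real.Gamma (((m + 1 : ℕ) : ℝ) / 2) *
        dualityCoeff (m + 1) d := by
  have hG : 0 < Real.Gamma (((m + 1 : ℕ) : ℝ) / 2) := Real.Gamma_pos_of_pos (by positivity)
  simp_rw [add_pow_mul_exp_eq_sum]
  rw [integral_finsetSum _ fun i _ ↦
    (integrableOn_pow_mul_exp_neg_sq_div_two (m - i)).const_mul _, dualityCoeff, Finset.mul_sum]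
  refine Finset.sum_congr rfl fun i hi ↦ ?_
  have him : i ≤ m := by simpa [Nat.lt_succ_iff] using hi
  rw [integral_const_mul, integral_pow_mul_exp_neg_sq_div_two, Nat.cast_sub him,
    Nat.add_sub_cancel,
    show ((m : ℝ) - i + 1) / 2 = ((m + 1 : ℕ) : ℝ) / 2 - (i : ℝ) / 2 by push_cast; ring,
    Real.rpow_sub (by norm_num), sub_div]
  field_simp

/-! ### The shell potential -/

/-- Minus the exponent of the unnormalised output density used for inputs of norm at most `d`:
it is the constant `dim E / 2` on the ball of radius `d`, and half the squared distance to that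
ball outside of it. -/
noncomputable def shellPotential {E : Type*} [NormedAddCommGroup E] [InnerProductSpace ℝ E]
    (d : ℝ) (y : E) : ℝ :=
  if ‖y‖ ≤ d then (Module.finrank ℝ E : ℝ) / 2 else (‖y‖ - d) ^ 2 / 2

lemma measurable_shellPotential {E : Type*} [NormedAddCommGroup E] [InnerProductSpace ℝ E]
    [MeasurableSpace E] [BorelSpace E] (d : ℝ) : Measurable (shellPotential d : E → ℝ) :=
  Measurable.ite (measurableSet_le (by fun_prop) (by fun_prop)) (by fun_prop) (by fun_prop)

lemma shellPotential_nonneg {E : Type*} [NormedAddCommGroup E] [InnerProductSpace ℝ E]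
    (d : ℝ) (y : E) : 0 ≤ shellPotential d y := by
  unfold shellPotential; split_ifs <;> positivity

lemma shellPotential_le {E : Type*} [NormedAddCommGroup E] [InnerProductSpace ℝ E]
    {d : ℝ} (hd : 0 ≤ d) (y : E) :
    shellPotential d y ≤ (Module.finrank ℝ E : ℝ) / 2 + ‖y‖ ^ 2 := by
  unfold shellPotential
  split_ifs with h
  · linarith [sq_nonneg ‖y‖]
  · have : (0 : ℝ) ≤ (Module.finrank ℝ E : ℝ) := by positivity
    push Not at h
    nlinarith [norm_nonneg y]

section
variable {E : Type*} [NormedAddCommGroup E] [InnerProductSpace ℝ E] [FiniteDimensional ℝ E]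
  [MeasurableSpace E] [BorelSpace E]

/-- Polar coordinates, in the form of a sign criterion: an integral over `E` is nonpositive as soon
as the radial integral along each ray is. -/
lemma integral_nonpos_of_forall_ray [Nontrivial E] {f : E → ℝ} (hf : Integrable f)
    (hray : ∀ θ : E, ‖θ‖ = 1 →
      ∫ r in Ioi (0 : ℝ), r ^ (Module.finrank ℝ E - 1) * f (r • θ) ≤ 0) :
    ∫ y, f y ≤ 0 := by
  have hmp := (volume : Measure E).measurePreserving_homeomorphUnitSphereProd
  have hcoe : ∀ y : ({(0 : E)}ᶜ : Set E),
      (homeomorphUnitSphereProd E y).2.1 • ((homeomorphUnitSphereProd E y).1 : E) = y := by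
    intro y
    exact congrArg Subtype.val ((homeomorphUnitSphereProd E).symm_apply_apply y)
  set F : Metric.sphere (0 : E) 1 × Ioi (0 : ℝ) → ℝ := fun p ↦ f (p.2.1 • (p.1 : E)) with hF
  have hcomp : F ∘ homeomorphUnitSphereProd E = f ∘ Subtype.val := by
    ext y; exact congrArg f (hcoe y)
  have hint : Integrable F ((volume : Measure E).toSphere.prod
      (Measure.volumeIoiPow (Module.finrank ℝ E - 1))) := by
    rw [← hmp.integrable_comp_emb (Homeomorph.measurableEmbedding _), hcomp]
    rw [← integrableOn_iff_comap_subtypeVal (measurableSet_singleton _).compl]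
    exact hf.integrableOn
  have heq : ∫ y, f y = ∫ p, F p ∂((volume : Measure E).toSphere.prod
      (Measure.volumeIoiPow (Module.finrank ℝ E - 1))) := by
    rw [← hmp.integral_comp (Homeomorph.measurableEmbedding _)]
    calc ∫ y, f y = ∫ y in ({(0 : E)}ᶜ : Set E), f y := by rw [restrict_compl_singleton]
      _ = ∫ y : ({(0 : E)}ᶜ : Set E), f y ∂(Measure.comap Subtype.val volume) :=
        (integral_subtype_comap (measurableSet_singleton _).compl f).symm
      _ = _ := by
        refine integral_congr_ae (ae_of_all _ fun y ↦ ?_)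
        exact (congrFun hcomp y).symm
  rw [heq, integral_prod _ hint]
  refine integral_nonpos fun θ ↦ ?_
  have hθ : ‖(θ : E)‖ = 1 := by simp
  refine le_of_eq_of_le ?_ (hray θ hθ)
  simp only [Measure.volumeIoiPow, ENNReal.ofReal, hF]
  rw [integral_withDensity_eq_integral_smul
    (measurable_subtype_coe.pow_const _).real_toNNReal,
    integral_subtype_comap measurableSet_Ioi
      fun r ↦ Real.toNNReal (r ^ (Module.finrank ℝ E - 1)) • f (r • (θ : E))]
  refine setIntegral_congr_fun measurableSet_Ioi fun r hr ↦ ?_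
  simp only [NNReal.smul_def, Real.coe_toNNReal _ (pow_nonneg (le_of_lt hr) _), smul_eq_mul]

lemma integrable_norm_sq_stdGaussian : Integrable (fun z : E ↦ ‖z‖ ^ 2) (stdGaussian E) :=
  (IsGaussian.memLp_two_id (μ := stdGaussian E)).integrable_norm_pow (by norm_num)

lemma integral_norm_sq_stdGaussian :
    ∫ z : E, ‖z‖ ^ 2 ∂(stdGaussian E) = Module.finrank ℝ E := by
  set b := stdOrthonormalBasis ℝ E
  have hb : ∀ z : E, ‖z‖ ^ 2 = ∑ i, (inner ℝ (b i) z) ^ 2 := fun z ↦ by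
    rw [← b.sum_sq_norm_inner_right]; simp
  have hone : ∀ i, ∫ z : E, (inner ℝ (b i) z) ^ 2 ∂(stdGaussian E) = 1 := by
    intro i
    have hv := variance_dual_stdGaussian (E := E) (innerSL ℝ (b i))
    rw [variance_of_integral_eq_zero (by fun_prop) (integral_strongDual_stdGaussian _)] at hv
    simpa using hv
  simp_rw [hb]
  rw [integral_finsetSum]
  · simp [hone]
  · intro i _
    refine integrable_norm_sq_stdGaussian.mono' (by fun_prop) (ae_of_all _ fun z ↦ ?_)
    rw [hb z, Real.norm_of_nonneg (sq_nonneg _)]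
    exact Finset.single_le_sum (f := fun j ↦ (inner ℝ (b j) z) ^ 2)
      (fun j _ ↦ sq_nonneg _) (Finset.mem_univ i)

/-- The integrand of `klDiv_gaussianChannel_le` is integrable for almost surely bounded inputs and
for a potential of at most quadratic growth. -/
lemma integrable_prod_sub_norm_sq {F : Type*} [MeasurableSpace F] (P : Measure F)
    [IsProbabilityMeasure P] {L : F → E} (hL : Measurable L) {M : ℝ}
    (hM : ∀ᵐ x ∂P, ‖L x‖ ≤ M) {ρ : E → ℝ} (hρ : Measurable ρ) (hρ0 : ∀ y, 0 ≤ ρ y) {c : ℝ}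
    (hρc : ∀ y, ρ y ≤ c + ‖y‖ ^ 2) :
    Integrable (fun p : F × E ↦ ρ (L p.1 + p.2) - ‖p.2‖ ^ 2 / 2) (P.prod (stdGaussian E)) := by
  have h2 : Integrable (fun p : F × E ↦ ‖p.2‖ ^ 2) (P.prod (stdGaussian E)) :=
    integrable_norm_sq_stdGaussian.comp_snd P
  refine Integrable.sub ?_ (h2.div_const 2)
  refine ((integrable_const (c + 2 * M ^ 2)).add (h2.const_mul 2)).mono'
    (by fun_prop : Measurable fun p : F × E ↦ ρ (L p.1 + p.2)).aestronglyMeasurable ?_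
  have hM' : ∀ᵐ p ∂(P.prod (stdGaussian E)), ‖L p.1‖ ≤ M :=
    Measure.quasiMeasurePreserving_fst.ae hM
  filter_upwards [hM'] with p hp
  rw [Real.norm_of_nonneg (hρ0 _)]
  have h1 := hρc (L p.1 + p.2)
  have h3 : ‖L p.1 + p.2‖ ≤ ‖L p.1‖ + ‖p.2‖ := norm_add_le _ _
  simp only [Pi.add_apply]
  have h4 : ‖L p.1‖ ^ 2 ≤ M ^ 2 := by gcongr
  have h5 : ‖L p.1 + p.2‖ ^ 2 ≤ (‖L p.1‖ + ‖p.2‖) ^ 2 := by gcongr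
  nlinarith [sq_nonneg (‖L p.1‖ - ‖p.2‖)]

lemma integrable_add_stdGaussian (s : E) {ρ : E → ℝ} (hρ : Measurable ρ)
    (hρ0 : ∀ y, 0 ≤ ρ y) {c : ℝ} (hρc : ∀ y, ρ y ≤ c + ‖y‖ ^ 2) :
    Integrable (fun z : E ↦ ρ (s + z)) (stdGaussian E) := by
  refine ((integrable_const (c + 2 * ‖s‖ ^ 2)).add
    (integrable_norm_sq_stdGaussian.const_mul 2)).mono'
    (by fun_prop : Measurable fun z ↦ ρ (s + z)).aestronglyMeasurable (ae_of_all _ fun z ↦ ?_)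
  rw [Real.norm_of_nonneg (hρ0 _)]
  have h1 := hρc (s + z)
  have h5 : ‖s + z‖ ^ 2 ≤ (‖s‖ + ‖z‖) ^ 2 := by gcongr; exact norm_add_le _ _
  simp only [Pi.add_apply]
  nlinarith [sq_nonneg (‖s‖ - ‖z‖)]

/-- The comparison density on `E` with potential `shellPotential d` satisfies the hypothesis of the
duality bound at every input of norm at most `d`. -/
lemma integral_shellPotential_sub_le [Nontrivial E] {d : ℝ} {s : E} (hs : ‖s‖ ≤ d) :
    ∫ z, (shellPotential d (s + z) - ‖z‖ ^ 2 / 2) ∂(stdGaussian E) ≤ 0 := by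
  have hd : 0 ≤ d := (norm_nonneg s).trans hs
  have hc := gaussConst_pos (E := E)
  set n := Module.finrank ℝ E with hn
  have hn0 : 0 < n := Module.finrank_pos
  have hi := integrable_add_stdGaussian s (measurable_shellPotential d)
    (shellPotential_nonneg d) (shellPotential_le hd)
  -- the second moment of the noise is `n`, so `‖z‖² / 2` may be replaced by the constant `n / 2`
  have hmoment : ∫ z, (shellPotential d (s + z) - ‖z‖ ^ 2 / 2) ∂(stdGaussian E) =
      ∫ z, (shellPotential d (s + z) - n / 2) ∂(stdGaussian E) := by
    rw [integral_sub hi (integrable_norm_sq_stdGaussian.div_const 2),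
      integral_sub hi (integrable_const _), integral_div, integral_norm_sq_stdGaussian]
    simp [hn]
  set f : E → ℝ := fun y ↦
    Real.exp (-‖y - s‖ ^ 2 / 2) / gaussConst E * (shellPotential d y - n / 2) with hf
  have hi' := hi.sub (integrable_const ((n : ℝ) / 2))
  rw [stdGaussian_eq_withDensity, integrable_withDensity_iff_integrable_smul'
    (by fun_prop) (by simp)] at hi'
  have hdens : ∀ z : E, (ENNReal.ofReal (Real.exp (-‖z‖ ^ 2 / 2) / gaussConst E)).toReal •
      (shellPotential d (s + z) - n / 2) = f (s + z) := by
    intro z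
    rw [ENNReal.toReal_ofReal (by positivity), smul_eq_mul, hf]
    simp
  have hfint : Integrable f := by
    rw [← (measurePreserving_add_left volume s).integrable_comp_emb
      (measurableEmbedding_addLeft s)]
    exact hi'.congr (ae_of_all _ fun z ↦ hdens z)
  rw [hmoment, stdGaussian_eq_withDensity, integral_withDensity_eq_integral_toReal_smul
    (by fun_prop) (by simp)]
  simp_rw [hdens]
  rw [integral_add_left_eq_self f s]
  refine integral_nonpos_of_forall_ray hfint fun θ hθ ↦ ?_
  have hnorm : ∀ r : ℝ, 0 < r → ‖r • θ‖ = r := fun r hr ↦ by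
    rw [norm_smul, hθ, mul_one, Real.norm_of_nonneg hr.le]
  -- inside the ball the potential equals `n / 2`, so that part contributes nothing
  have hrestrict : ∫ r in Ioi (0 : ℝ), r ^ (n - 1) * f (r • θ) =
      ∫ r in Ioi d, r ^ (n - 1) * f (r • θ) := by
    refine setIntegral_eq_of_subset_of_forall_sdiff_eq_zero measurableSet_Ioi
      (Ioi_subset_Ioi hd) fun r hr ↦ ?_
    have h0 : 0 < r := hr.1
    have hrd : r ≤ d := not_lt.1 hr.2
    simp [hf, shellPotential, hnorm r h0, hrd, hn]
  rw [hrestrict, setIntegral_Ioi_eq_comp_add]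
  -- along the ray through `θ`, the Gaussian centred at `s` is a one-dimensional Gaussian
  -- centred at the projection `⟪θ, s⟫`, which is at most `d`
  set u : ℝ := inner ℝ θ s with hu
  have hud : u ≤ d := by
    calc u ≤ ‖θ‖ * ‖s‖ := real_inner_le_norm θ s
      _ ≤ d := by rw [hθ, one_mul]; exact hs
  obtain ⟨m, hm⟩ : ∃ m, n = m + 1 := ⟨n - 1, by omega⟩
  have hpt : ∀ t ∈ Ioi (0 : ℝ), (t + d) ^ (n - 1) * f ((t + d) • θ) =
      Real.exp (-(‖s‖ ^ 2 - u ^ 2) / 2) / gaussConst E / 2 *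
        ((t + d) ^ m * ((t ^ 2 - (m + 1)) * Real.exp (-(t + (d - u)) ^ 2 / 2))) := by
    intro t ht
    have ht : 0 < t := ht
    have h1 : ‖(t + d) • θ - s‖ ^ 2 = (t + (d - u)) ^ 2 + (‖s‖ ^ 2 - u ^ 2) := by
      rw [norm_sub_sq_real, hnorm _ (by positivity), real_inner_smul_left]
      ring
    have h2 : ¬ t + d ≤ d := by linarith
    simp only [hf, shellPotential, hnorm _ (show 0 < t + d by positivity), h2, if_false, h1]
    rw [show -((t + (d - u)) ^ 2 + (‖s‖ ^ 2 - u ^ 2)) / 2 =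
      -(‖s‖ ^ 2 - u ^ 2) / 2 + -(t + (d - u)) ^ 2 / 2 by ring, Real.exp_add, hm]
    simp only [Nat.add_sub_cancel]
    push_cast
    ring
  rw [setIntegral_congr_fun measurableSet_Ioi hpt, integral_const_mul]
  exact mul_nonpos_of_nonneg_of_nonpos (by positivity)
    (integral_radial_moment_le hd (by linarith))

lemma finrank_mul_volume_real_ball [Nontrivial E] :
    (Module.finrank ℝ E : ℝ) * volume.real (Metric.ball (0 : E) 1) =
      2 * Real.pi ^ ((Module.finrank ℝ E : ℝ) / 2) / Real.Gamma ((Module.finrank ℝ E : ℝ) / 2) := by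
  have hn : (0 : ℝ) < Module.finrank ℝ E := by exact_mod_cast Module.finrank_pos
  have hG : 0 < Real.Gamma ((Module.finrank ℝ E : ℝ) / 2) := Real.Gamma_pos_of_pos (by positivity)
  rw [measureReal_def, InnerProductSpace.volume_ball, ENNReal.ofReal_one, one_pow, one_mul,
    Real.Gamma_add_one (by positivity), ENNReal.toReal_ofReal (by positivity),
    Real.sqrt_eq_rpow, ← Real.rpow_mul_natCast Real.pi_pos.le]
  rw [show (1 / 2 : ℝ) * (Module.finrank ℝ E : ℝ) = (Module.finrank ℝ E : ℝ) / 2 by ring]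
  field_simp

/-- The constant part of the density contributes the volume of the ball, and the Gaussian tail
outside of it contributes `dualityCoeff`, by the binomial theorem. -/
lemma integral_exp_neg_shellPotential [Nontrivial E] {d : ℝ} (hd : 0 ≤ d) :
    ∫ y : E, Real.exp (-shellPotential d y) = gaussConst E *
      (dualityCoeff (Module.finrank ℝ E) d + volume.real (Metric.closedBall (0 : E) d) /
        (2 * Real.pi * Real.exp 1) ^ ((Module.finrank ℝ E : ℝ) / 2)) := by
  have hball := Measure.addHaar_real_closedBall (volume : Measure E) 0 hd
  have hV := finrank_mul_volume_real_ball (E := E)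
  obtain ⟨m, hm⟩ : ∃ m, Module.finrank ℝ E = m + 1 :=
    ⟨_, (Nat.succ_pred_eq_of_pos Module.finrank_pos).symm⟩
  set F : ℝ → ℝ := fun r ↦
    Real.exp (-(if r ≤ d then (Module.finrank ℝ E : ℝ) / 2 else (r - d) ^ 2 / 2)) with hF
  have hrad := integral_fun_norm_addHaar (volume : Measure E) F
  have hshell : ∀ y : E, Real.exp (-shellPotential d y) = F ‖y‖ := fun y ↦ rfl
  simp_rw [hshell]
  rw [hrad]
  simp only [smul_eq_mul, nsmul_eq_mul]
  rw [gaussConst, hball]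
  rw [hm] at hV hF ⊢
  rw [Nat.add_sub_cancel]
  have hin : EqOn (fun r ↦ r ^ m * F r)
      (fun r ↦ r ^ m * Real.exp (-(((m + 1 : ℕ) : ℝ) / 2))) (Ioc 0 d) := fun r hr ↦ by
    simp only [hF, if_pos hr.2]
  have hout : EqOn (fun r ↦ r ^ m * F r)
      (fun r ↦ ((r - d) + d) ^ m * Real.exp (-(r - d) ^ 2 / 2)) (Ioi d) := fun r hr ↦ by
    simp only [hF, if_neg (not_le.2 (mem_Ioi.1 hr)), sub_add_cancel, neg_div]
  have hsplit : ∫ r in Ioi (0 : ℝ), r ^ m * F r =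
      (∫ r in Ioc 0 d, r ^ m * F r) + ∫ r in Ioi d, r ^ m * F r := by
    rw [← Ioc_union_Ioi_eq_Ioi hd, setIntegral_union (Ioc_disjoint_Ioi le_rfl) measurableSet_Ioi]
    · refine IntegrableOn.congr_fun ?_ hin.symm measurableSet_Ioc
      exact Continuous.integrableOn_Ioc (by fun_prop)
    · refine IntegrableOn.congr_fun ?_ hout.symm measurableSet_Ioi
      rw [← (measurePreserving_add_right volume d).integrableOn_comp_preimage
        (measurableEmbedding_addRight d)]
      simpa [Function.comp_def] using integrableOn_add_pow_mul_exp m d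
  rw [hsplit, setIntegral_congr_fun measurableSet_Ioc hin,
    setIntegral_congr_fun measurableSet_Ioi hout, setIntegral_Ioi_eq_comp_add,
    integral_mul_const, ← intervalIntegral.integral_of_le hd, integral_pow]
  simp only [add_sub_cancel_right]
  rw [integral_add_pow_mul_exp, ← mul_assoc, mul_add]
  have hG : 0 < Real.Gamma (((m + 1 : ℕ) : ℝ) / 2) := Real.Gamma_pos_of_pos (by positivity)
  have h1 : ((m + 1 : ℕ) : ℝ) * volume.real (Metric.ball (0 : E) 1) *
      ((d ^ (m + 1) - 0 ^ (m + 1)) / ((m : ℝ) + 1) * Real.exp (-(((m + 1 : ℕ) : ℝ) / 2))) =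
      (2 * Real.pi) ^ (((m + 1 : ℕ) : ℝ) / 2) *
        (d ^ (m + 1) * volume.real (Metric.ball (0 : E) 1) /
        (2 * Real.pi * Real.exp 1) ^ (((m + 1 : ℕ) : ℝ) / 2)) := by
    rw [Real.mul_rpow (x := 2 * Real.pi) (by positivity) (by positivity), Real.exp_one_rpow,
      Real.exp_neg]
    push_cast
    field_simp
    simp
  have h2 : ((m + 1 : ℕ) : ℝ) * volume.real (Metric.ball (0 : E) 1) *
      (2 ^ (((m + 1 : ℕ) : ℝ) / 2) / 2 * Real.Gamma (((m + 1 : ℕ) : ℝ) / 2) *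
        dualityCoeff (m + 1) d) =
      (2 * Real.pi) ^ (((m + 1 : ℕ) : ℝ) / 2) * dualityCoeff (m + 1) d := by
    rw [hV, Real.mul_rpow (by positivity) (by positivity)]
    field_simp
  rw [h1, h2]
  ring

end

/-! ### The coefficient `dualityCoeff`, enclosing balls and boxes -/

lemma one_le_dualityCoeff {n : ℕ} (hn : 1 ≤ n) {r : ℝ} (hr : 0 ≤ r) : 1 ≤ dualityCoeff n r := by
  have hpos : ∀ i ∈ Finset.range n, 0 ≤ ((n - 1).choose i : ℝ) *
      (Real.Gamma (((n : ℝ) - i) / 2) / ((2 : ℝ) ^ ((i : ℝ) / 2) * Real.Gamma ((n : ℝ) / 2))) *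
        r ^ i := by
    intro i hi
    have h : (i : ℝ) ≤ n := by exact_mod_cast (Finset.mem_range.1 hi).le
    have h1 := Real.Gamma_nonneg_of_nonneg (s := ((n : ℝ) - i) / 2) (by linarith)
    have h2 := Real.Gamma_nonneg_of_nonneg (s := (n : ℝ) / 2) (by positivity)
    positivity
  have hG : Real.Gamma ((n : ℝ) / 2) ≠ 0 := (Real.Gamma_pos_of_pos (by positivity)).ne'
  refine le_of_eq_of_le ?_ (Finset.single_le_sum hpos (Finset.mem_range.2 hn))
  simp [hG]

lemma dualityCoeff_one (r : ℝ) : dualityCoeff 1 r = 1 := by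
  have hG : Real.Gamma ((1 : ℝ) / 2) ≠ 0 := (Real.Gamma_pos_of_pos (by positivity)).ne'
  simp [dualityCoeff, div_self hG, -one_div]

lemma norm_le_rMax {n : ℕ} {S : Set (EuclideanSpace ℝ (Fin n))} (hS : Bornology.IsBounded S)
    {y : EuclideanSpace ℝ (Fin n)} (hy : y ∈ S) : ‖y‖ ≤ rMax S := by
  obtain ⟨r, hr⟩ := hS.subset_closedBall 0
  refine le_csInf ⟨max r 0, le_max_right _ _,
    hr.trans (Metric.closedBall_subset_closedBall (le_max_left _ _))⟩ ?_
  rintro r' ⟨-, hr'⟩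
  simpa using hr' hy

lemma rMax_nonneg {n : ℕ} (S : Set (EuclideanSpace ℝ (Fin n))) : 0 ≤ rMax S :=
  Real.sInf_nonneg fun _ hr ↦ hr.1

lemma exists_box_eq_smallestBox {n : ℕ} {S : Set (EuclideanSpace ℝ (Fin n))}
    (hS : Bornology.IsBounded S) :
    ∃ A : Fin n → ℝ, (∀ i, 0 ≤ A i) ∧ box A = smallestBox S := by
  set T : Set (Fin n → ℝ) := {a | (∀ i, 0 ≤ a i) ∧ S ⊆ box a} with hT
  obtain ⟨r, hr⟩ := hS.subset_closedBall 0
  have hne : T.Nonempty := by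
    refine ⟨fun _ ↦ max r 0, fun _ ↦ le_max_right _ _, fun y hy i ↦ ?_⟩
    have h1 : ‖y‖ ≤ r := by simpa using hr hy
    exact ((PiLp.norm_apply_le y i).trans h1).trans (le_max_left _ _)
  have hbdd : ∀ i, BddBelow ((fun a : Fin n → ℝ ↦ a i) '' T) := fun i ↦
    ⟨0, by rintro _ ⟨a, ha, rfl⟩; exact ha.1 i⟩
  -- the smallest box has as half-widths the coordinatewise infima of the admissible ones
  refine ⟨fun i ↦ sInf ((fun a ↦ a i) '' T), fun i ↦ Real.sInf_nonneg ?_, ?_⟩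
  · rintro _ ⟨a, ha, rfl⟩
    exact ha.1 i
  · ext y
    simp only [smallestBox, mem_sInter]
    constructor
    · rintro hy _ ⟨a, ha0, haS, rfl⟩ i
      exact (hy i).trans (csInf_le (hbdd i) ⟨a, ⟨ha0, haS⟩, rfl⟩)
    · intro hy i
      refine le_csInf (hne.image _) ?_
      rintro _ ⟨a, ha, rfl⟩
      exact hy _ ⟨a, ha.1, ha.2, rfl⟩ i

/-! ### Capacity bounds -/

/-- `klDiv_gaussianChannel_le` for all input laws at once, in bits. -/
lemma channelCapacity_le_logb {nr nt : ℕ} {𝒳 : Set (EuclideanSpace ℝ (Fin nt))}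
    {H : Matrix (Fin nr) (Fin nt) ℝ} (hbdd : Bornology.IsBounded (matImage H 𝒳))
    {ρ : EuclideanSpace ℝ (Fin nr) → ℝ} (hρ : Measurable ρ) (hρ0 : ∀ y, 0 ≤ ρ y) {c : ℝ}
    (hρc : ∀ y, ρ y ≤ c + ‖y‖ ^ 2) {K : ℝ} (hK : 1 ≤ K)
    (hnorm : ∫ y, Real.exp (-ρ y) = gaussConst (EuclideanSpace ℝ (Fin nr)) * K)
    (hle : ∀ s ∈ matImage H 𝒳, ∫ z, (ρ (s + z) - ‖z‖ ^ 2 / 2)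
      ∂(stdGaussian (EuclideanSpace ℝ (Fin nr))) ≤ 0) :
    ((channelCapacity 𝒳 H : ℝ≥0∞) : EReal) ≤ ((Real.logb 2 K : ℝ) : EReal) := by
  -- nonnegativity is needed because `ENNReal.ofReal` truncates negative values
  have hlog : 0 ≤ Real.logb 2 K := Real.logb_nonneg (by norm_num) hK
  rw [← max_eq_left hlog, ← EReal.coe_ennreal_ofReal, EReal.coe_ennreal_le_coe_ennreal_iff]
  refine iSup_le fun P ↦ iSup_le fun hP ↦ iSup_le fun hPX ↦ ?_
  obtain ⟨M, hM⟩ := hbdd.subset_closedBall 0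
  have hL : Measurable (Matrix.toEuclideanLin H) :=
    (LinearMap.continuous_of_finiteDimensional _).measurable
  have hint := integrable_prod_sub_norm_sq P hL (M := M)
    (hPX.mono fun x hx ↦ by simpa using hM ⟨x, hx, rfl⟩) hρ hρ0 hρc
  have key := klDiv_gaussianChannel_le P hL hρ (zero_lt_one.trans_le hK) hnorm hint
    (hPX.mono fun x hx ↦ hle _ ⟨x, hx, rfl⟩)
  rw [Real.logb, ENNReal.ofReal_div_of_pos (Real.log_pos (by norm_num))]
  exact ENNReal.div_le_div_right key _

/-- The potential of the product output density used for inputs in `box A`: the sum over the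
coordinates of the one-dimensional shell potentials. -/
noncomputable def boxPotential {n : ℕ} (A : Fin n → ℝ) (y : EuclideanSpace ℝ (Fin n)) : ℝ :=
  ∑ i, shellPotential (A i) (y i)

lemma measurable_boxPotential {n : ℕ} (A : Fin n → ℝ) : Measurable (boxPotential A) :=
  Finset.measurable_sum _ fun i _ ↦ (measurable_shellPotential (A i)).comp (by fun_prop)

lemma boxPotential_nonneg {n : ℕ} (A : Fin n → ℝ) (y : EuclideanSpace ℝ (Fin n)) :
    0 ≤ boxPotential A y :=
  Finset.sum_nonneg fun _ _ ↦ shellPotential_nonneg _ _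

lemma boxPotential_le {n : ℕ} {A : Fin n → ℝ} (hA : ∀ i, 0 ≤ A i)
    (y : EuclideanSpace ℝ (Fin n)) : boxPotential A y ≤ (n : ℝ) / 2 + ‖y‖ ^ 2 := by
  rw [EuclideanSpace.norm_sq_eq]
  refine (Finset.sum_le_sum fun i _ ↦ shellPotential_le (hA i) (y i)).trans_eq ?_
  rw [Finset.sum_add_distrib]
  simp
  ring

lemma integral_exp_neg_boxPotential {n : ℕ} {A : Fin n → ℝ} (hA : ∀ i, 0 ≤ A i) :
    ∫ y, Real.exp (-boxPotential A y) = gaussConst (EuclideanSpace ℝ (Fin n)) *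
      ∏ i, (1 + 2 * A i / Real.sqrt (2 * Real.pi * Real.exp 1)) := by
  rw [← (PiLp.volume_preserving_toLp (Fin n)).integral_comp
    (MeasurableEquiv.toLp 2 (Fin n → ℝ)).measurableEmbedding]
  have h1 : ∀ x : Fin n → ℝ, Real.exp (-boxPotential A (WithLp.toLp 2 x)) =
      ∏ i, Real.exp (-shellPotential (A i) (x i)) := fun x ↦ by
    rw [boxPotential, ← Finset.sum_neg_distrib, Real.exp_sum]
  simp_rw [h1]
  rw [integral_fintype_prod_volume_eq_prod (f := fun i (t : ℝ) ↦
    Real.exp (-shellPotential (A i) t))]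
  have h2 : ∀ i, ∫ t : ℝ, Real.exp (-shellPotential (A i) t) = gaussConst ℝ *
      (1 + 2 * A i / Real.sqrt (2 * Real.pi * Real.exp 1)) := fun i ↦ by
    have h0 := hA i
    rw [integral_exp_neg_shellPotential (hA i), Module.finrank_self, dualityCoeff_one,
      measureReal_def, Real.volume_closedBall, ENNReal.toReal_ofReal (by positivity),
      Real.sqrt_eq_rpow, Nat.cast_one]
  simp_rw [h2]
  rw [Finset.prod_mul_distrib]
  congr 1
  simp only [gaussConst, Module.finrank_self, finrank_euclideanSpace, Finset.prod_const,
    Finset.card_univ, Fintype.card_fin]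
  rw [← Real.rpow_mul_natCast (by positivity)]
  congr 1
  push_cast
  ring

lemma stdGaussian_real : stdGaussian ℝ = gaussianReal 0 1 := by
  refine Measure.ext_of_charFun ?_
  ext t
  rw [charFun_stdGaussian, charFun_gaussianReal]
  simp [neg_div, ← Complex.ofReal_pow]

lemma integral_stdGaussian_comp_apply {n : ℕ} (i : Fin n) {f : ℝ → ℝ} (hf : Measurable f) :
    ∫ z, f (z i) ∂(stdGaussian (EuclideanSpace ℝ (Fin n))) = ∫ t, f t ∂(stdGaussian ℝ) := by
  rw [← map_pi_eq_stdGaussian, integral_map (by fun_prop)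
    (by fun_prop : Measurable fun z : EuclideanSpace ℝ (Fin n) ↦ f (z i)).aestronglyMeasurable,
    stdGaussian_real]
  exact integral_comp_eval (μ := fun _ : Fin n ↦ gaussianReal 0 1) hf.aestronglyMeasurable

lemma integrable_stdGaussian_comp_apply {n : ℕ} (i : Fin n) {f : ℝ → ℝ} (hf : Measurable f)
    (hfi : Integrable f (stdGaussian ℝ)) :
    Integrable (fun z ↦ f (z i)) (stdGaussian (EuclideanSpace ℝ (Fin n))) := by
  rw [← map_pi_eq_stdGaussian, integrable_map_measure
    (by fun_prop : Measurable fun z : EuclideanSpace ℝ (Fin n) ↦ f (z i)).aestronglyMeasurable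
    (by fun_prop)]
  rw [stdGaussian_real] at hfi
  exact integrable_comp_eval (μ := fun _ : Fin n ↦ gaussianReal 0 1) hfi

lemma integral_boxPotential_sub_le {n : ℕ} {A : Fin n → ℝ} {s : EuclideanSpace ℝ (Fin n)}
    (hs : s ∈ box A) :
    ∫ z, (boxPotential A (s + z) - ‖z‖ ^ 2 / 2) ∂(stdGaussian (EuclideanSpace ℝ (Fin n))) ≤ 0 := by
  have h1 : ∀ z : EuclideanSpace ℝ (Fin n), boxPotential A (s + z) - ‖z‖ ^ 2 / 2 =
      ∑ i, (shellPotential (A i) (s i + z i) - ‖z i‖ ^ 2 / 2) := fun z ↦ by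
    rw [EuclideanSpace.norm_sq_eq, boxPotential, Finset.sum_sub_distrib, Finset.sum_div]
    simp
  have hm : ∀ i, Measurable (fun t : ℝ ↦ shellPotential (A i) (s i + t) - ‖t‖ ^ 2 / 2) := fun i ↦
    ((measurable_shellPotential (A i)).comp (measurable_const_add _)).sub (by fun_prop)
  simp_rw [h1]
  rw [integral_finsetSum]
  · refine Finset.sum_nonpos fun i _ ↦ ?_
    rw [integral_stdGaussian_comp_apply i (hm i)]
    exact integral_shellPotential_sub_le (hs i)
  · intro i _
    refine integrable_stdGaussian_comp_apply i (hm i) (Integrable.sub ?_ ?_)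
    · exact integrable_add_stdGaussian (s i) (measurable_shellPotential (A i))
        (shellPotential_nonneg _) (shellPotential_le ((abs_nonneg _).trans (hs i)))
    · exact integrable_norm_sq_stdGaussian.div_const 2

theorem mainTheorem5 {nr nt : ℕ} (hnr : 1 ≤ nr) (hnt : 1 ≤ nt)
    (𝒳 : Set (EuclideanSpace ℝ (Fin nt))) (hconv : Convex ℝ 𝒳) (hcomp : IsCompact 𝒳)
    (hzero : (0 : EuclideanSpace ℝ (Fin nt)) ∈ 𝒳) (H : Matrix (Fin nr) (Fin nt) ℝ) :
    ((channelCapacity 𝒳 H : ℝ≥0∞) : EReal) ≤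
      ((Real.logb 2 (dualityCoeff nr (rMax (matImage H 𝒳)) +
        volume.real
            (Metric.closedBall (0 : EuclideanSpace ℝ (Fin nr)) (rMax (matImage H 𝒳))) /
          (2 * Real.pi * Real.exp 1) ^ ((nr : ℝ) / 2)) : ℝ) : EReal) ∧
    (∃ A : Fin nr → ℝ, (∀ i, 0 ≤ A i) ∧ box A = smallestBox (matImage H 𝒳)) ∧
    ∀ A : Fin nr → ℝ, (∀ i, 0 ≤ A i) → box A = smallestBox (matImage H 𝒳) →
      ((channelCapacity 𝒳 H : ℝ≥0∞) : EReal) ≤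
        ((∑ i, Real.logb 2 (1 + 2 * A i / Real.sqrt (2 * Real.pi * Real.exp 1)) : ℝ) : EReal) := by
  have hbdd : Bornology.IsBounded (matImage H 𝒳) :=
    (hcomp.image (LinearMap.continuous_of_finiteDimensional _)).isBounded
  have : Nonempty (Fin nr) := ⟨⟨0, hnr⟩⟩
  refine ⟨?_, exists_box_eq_smallestBox hbdd, fun A hA hbox ↦ ?_⟩
  · have hd := rMax_nonneg (matImage H 𝒳)
    refine channelCapacity_le_logb hbdd (measurable_shellPotential (rMax (matImage H 𝒳)))
      (shellPotential_nonneg _) (shellPotential_le hd) ?_ ?_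
      fun s hs ↦ integral_shellPotential_sub_le (norm_le_rMax hbdd hs)
    · exact (one_le_dualityCoeff hnr hd).trans (le_add_of_nonneg_right (by positivity))
    · have := integral_exp_neg_shellPotential (E := EuclideanSpace ℝ (Fin nr)) hd
      rwa [finrank_euclideanSpace, Fintype.card_fin] at this
  · have hsub : matImage H 𝒳 ⊆ box A := by
      rw [hbox]
      rintro y hy _ ⟨a, -, ha, rfl⟩
      exact ha hy
    have hfac : ∀ i, 1 ≤ 1 + 2 * A i / Real.sqrt (2 * Real.pi * Real.exp 1) := fun i ↦ by
      have := hA i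
      exact le_add_of_nonneg_right (by positivity)
    rw [← Real.logb_prod _ _ fun i _ ↦ (zero_lt_one.trans_le (hfac i)).ne']
    exact channelCapacity_le_logb hbdd (measurable_boxPotential A) (boxPotential_nonneg A)
      (boxPotential_le hA) (Finset.one_le_prod fun i _ ↦ hfac i)
      (integral_exp_neg_boxPotential hA) fun s hs ↦ integral_boxPotential_sub_le (hsub hs)
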